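/- Let $X$ be a second-countable $T_1$ space. The Choquet game $\mathsf{Ch}(X)$ is played by Empty and Nonempty in rounds $i=0,1,2,\dots$: in round $i$, Empty chooses a point $x_i\in X$ and an open set $U_i\ni x_i$ (with $U_i\subseteq V_{i-1}$ if $i\ge 1$), and Nonempty answers with an open set $V_i$ such that $x_i\in V_i\subseteq U_i$. Nonempty wins if $\bigcap_i V_i\neq\varnothing$. A strategy $\mathfrak S$ for Nonempty is stationary if $\mathfrak S(\langle x_j,U_j\rangle_{j\le i})=\mathfrak S(\langle x_i,U_i\rangle)$ for every partial play $\langle x_j,U_j\rangle_{j\le i}$ of Empty against $\mathfrak S$. A domain is a continuous directed-complete partial order: every nonempty directed subset has a supremum, and every element $y$ is the supremum of the set $\{x : x\ll y\}$, which is nonempty and directed; here $x\ll y$ means that whenever a nonempty directed set $d$ satisfies $y\le\sup d$, some $z\in d$ satisfies $x\le z$. The space $X$ is domain representable if it is homeomorphic to the set of maximal elements of some domain with the subspace topology inherited from the Scott topology. For a partially ordered set $P$, a filter is a nonempty, upward closed, downward directed subset of $P$; the MF space of $P$ is the set of all filters that are maximal under inclusion, with the topology generated by the sets $\{F : p\in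 F\}$, $p\in P$. Then the following are equivalent: 1. Nonempty has a stationary winning strategy in $\mathsf{Ch}(X)$. 2. $X$ is domain representable. 3. $X$ is homeomorphic to the MF space of some partially ordered set. -/

import Mathlib

open TopologicalSpace

/-! ### The (strong) Choquet game -/

/-- A move of Empty in the Choquet game on `X`: a point together with an open set containing it. -/
structure ChoquetMove (X : Type*) [TopologicalSpace X] where
  point : X
  nhd : Opens X
  mem : point ∈ nhd

/-- A strategy for Nonempty, as a rule: to every sequence `⟨x_j, U_j⟩_{j ≤ n}` of moves of Empty it
assigns an open set, the response of Nonempty in round `n`. -/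
def ChoquetStrategy (X : Type*) [TopologicalSpace X] :=
  (n : ℕ) → (Fin (n + 1) → ChoquetMove X) → Opens X

namespace ChoquetStrategy

variable {X : Type*} [TopologicalSpace X]

/-- The moves `m 0, …, m n` of Empty form a partial play against `S`: in each round `i + 1 ≤ n`
Empty plays an open set contained in the response of `S` in round `i`. -/
def IsPartialPlay (S : ChoquetStrategy X) {n : ℕ} (m : Fin (n + 1) → ChoquetMove X) : Prop :=
  ∀ i : Fin n, (m i.succ).nhd ≤
    S i fun j : Fin ((i : ℕ) + 1) => m (Fin.castLE (Nat.succ_le_succ i.isLt.le) j)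

/-- The response of `S` in round `n` to the infinite sequence `e` of moves of Empty. -/
def response (S : ChoquetStrategy X) (e : ℕ → ChoquetMove X) (n : ℕ) : Opens X :=
  S n fun j : Fin (n + 1) => e j

/-- The infinite sequence `e` of moves of Empty, answered by `S`, is a play of the game. -/
def IsPlay (S : ChoquetStrategy X) (e : ℕ → ChoquetMove X) : Prop :=
  ∀ n, (e (n + 1)).nhd ≤ S.response e n

/-- `S` obeys the rules: against every partial play, its response to the last move `⟨x_n, U_n⟩`
is an open set `V_n` with `x_n ∈ V_n ⊆ U_n`. -/
def IsLegal (S : ChoquetStrategy X) : Prop :=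
  ∀ (n : ℕ) (m : Fin (n + 1) → ChoquetMove X), S.IsPartialPlay m →
    (m (Fin.last n)).point ∈ S n m ∧ S n m ≤ (m (Fin.last n)).nhd

/-- `S` is a winning strategy for Nonempty: it obeys the rules, and `⋂ n, V_n` is nonempty for
every play that follows it. -/
def IsWinning (S : ChoquetStrategy X) : Prop :=
  S.IsLegal ∧ ∀ e : ℕ → ChoquetMove X, S.IsPlay e → (⋂ n, (S.response e n : Set X)).Nonempty

/-- `S` is stationary: it treats each move of Empty as if it were the first one. -/
def IsStationary (S : ChoquetStrategy X) : Prop :=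
  ∀ (n : ℕ) (m : Fin (n + 1) → ChoquetMove X), S.IsPartialPlay m →
    S n m = S 0 fun _ => m (Fin.last n)

end ChoquetStrategy

/-- Nonempty has a stationary winning strategy in the Choquet game on `X`. -/
def HasStationaryWinningStrategy (X : Type*) [TopologicalSpace X] : Prop :=
  ∃ S : ChoquetStrategy X, S.IsStationary ∧ S.IsWinning

/-! ### Domains -/

/-- The way-below relation of a partial order. -/
def WayBelow {D : Type*} [PartialOrder D] (x y : D) : Prop :=
  ∀ d : Set D, d.Nonempty → DirectedOn (· ≤ ·) d → ∀ a, IsLUB d a → y ≤ a → ∃ z ∈ d, x ≤ z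

/-- A domain is a continuous directed-complete partial order: every nonempty directed set has a
least upper bound, and every element is the directed supremum of the elements way below it. -/
structure IsContinuousDcpo (D : Type*) [PartialOrder D] : Prop where
  exists_isLUB : ∀ d : Set D, d.Nonempty → DirectedOn (· ≤ ·) d → ∃ a, IsLUB d a
  nonempty_wayBelow : ∀ y : D, {x | WayBelow x y}.Nonempty
  directedOn_wayBelow : ∀ y : D, DirectedOn (· ≤ ·) {x | WayBelow x y}
  isLUB_wayBelow : ∀ y : D, IsLUB {x | WayBelow x y} y

universe u v w

/-- `X` is domain representable: it is homeomorphic to the set of maximal elements of a domain,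
with the subspace topology inherited from the Scott topology. -/
def IsDomainRepresentable (X : Type u) [TopologicalSpace X] : Prop :=
  ∃ (D : Type v) (_ : PartialOrder D), IsContinuousDcpo D ∧
    Nonempty (X ≃ₜ {x : Topology.WithScott D // IsMax (Topology.WithScott.ofScott x)})

/-! ### MF spaces -/

/-- The set of maximal filters of the poset `P`. A filter is a nonempty, upward closed, downward
directed subset (not necessarily proper); maximality is with respect to inclusion. -/
def MaximalFilter (P : Type*) [PartialOrder P] :=
  {F : Order.PFilter P // IsMax F}

/-- The topology of the MF space of `P`, generated by the sets `{F | p ∈ F}` for `p` in `P`. -/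
instance MaximalFilter.instTopologicalSpace (P : Type*) [PartialOrder P] :
    TopologicalSpace (MaximalFilter P) :=
  generateFrom (Set.range fun p : P => {F : MaximalFilter P | p ∈ F.val})

/-- `X` is representable as an MF space: it is homeomorphic to the space of maximal filters of some
poset. -/
def IsMFRepresentable (X : Type u) [TopologicalSpace X] : Prop :=
  ∃ (P : Type v) (_ : PartialOrder P), Nonempty (X ≃ₜ MaximalFilter P)

open Topology

/-! ### Stationary strategies as functions of the last move -/

/-! A stationary strategy is a rule `σ` on single moves. Given `σ`, order a countable base by
"contained in a response to a move inside". A filter has a least element or a cofinal sequence that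
is a play won by Nonempty, so its members share a point; by T1 the maximal filters are exactly the
neighbourhood filters of points (`IsWinningRule.nonempty_homeomorph_maximalFilter`). Filters on any
poset form a continuous dcpo whose maximal elements are its MF space (`maximalFilterHomeomorph`).

Conversely, a domain yields a winning strategy with memory
(`IsDomainRepresentable.exists_isWinningSystem`). The memory is removed in
`IsWinningSystem.exists_isWinningRule`: histories are coded by finite lists over a countable set,
each list carrying an open set, so that a neighbourhood of a nonisolated point fits inside only
finitely many of these sets. Nonempty answers all the compatible histories at once. -/

/-- A winning rule for Nonempty which depends only on the last move of Empty. -/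
structure IsWinningRule {X : Type*} [TopologicalSpace X] (σ : ChoquetMove X → Opens X) : Prop where
  mem : ∀ m, m.point ∈ σ m
  le : ∀ m, σ m ≤ m.nhd
  nonempty_iInter : ∀ e : ℕ → ChoquetMove X, (∀ n, (e (n + 1)).nhd ≤ σ (e n)) →
    (⋂ n, (σ (e n) : Set X)).Nonempty

theorem HasStationaryWinningStrategy.exists_isWinningRule {X : Type*} [TopologicalSpace X]
    (h : HasStationaryWinningStrategy X) : ∃ σ : ChoquetMove X → Opens X, IsWinningRule σ := by
  obtain ⟨S, hstat, hlegal, hwin⟩ := h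
  have hpp : ∀ m : Fin (0 + 1) → ChoquetMove X, S.IsPartialPlay m := fun m i => i.elim0
  refine ⟨fun m => S 0 fun _ => m, fun m => (hlegal 0 _ (hpp _)).1,
    fun m => (hlegal 0 _ (hpp _)).2, fun e he => ?_⟩
  have key : ∀ n, S.response e n = S 0 fun _ => e n := by
    intro n
    induction n using Nat.strong_induction_on with
    | _ n ih =>
      -- Stationarity holds only on partial plays, so the earlier rounds are needed to see that this
      -- is one.
      refine hstat n (fun j => e j) fun i => ?_
      have h1 := ih i i.isLt
      exact (he i).trans_eq h1.symm
  have h := hwin e fun n => by rw [key]; exact he n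
  simpa only [key] using h

theorem IsWinningRule.hasStationaryWinningStrategy {X : Type*} [TopologicalSpace X]
    {σ : ChoquetMove X → Opens X} (h : IsWinningRule σ) : HasStationaryWinningStrategy X :=
  ⟨fun n m => σ (m (Fin.last n)), fun _ _ _ => rfl, fun _ _ _ => ⟨h.mem _, h.le _⟩,
    fun e he => h.nonempty_iInter e he⟩

/-! ### From a winning rule to an MF space -/

section MF

variable {X : Type*} [TopologicalSpace X] (σ : ChoquetMove X → Opens X)

/-- `U` is inside the response of `σ` to some move of Empty inside `V`. -/
def RefinesBy (U V : Opens X) : Prop :=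
  ∃ m : ChoquetMove X, m.nhd ≤ V ∧ U ≤ σ m

variable {σ}

theorem RefinesBy.le (h : IsWinningRule σ) {U V : Opens X} (hUV : RefinesBy σ U V) : U ≤ V :=
  let ⟨m, hm, hU⟩ := hUV
  hU.trans ((h.le m).trans hm)

theorem RefinesBy.trans_le {U V W : Opens X} (hUV : RefinesBy σ U V) (hVW : V ≤ W) :
    RefinesBy σ U W :=
  let ⟨m, hm, hU⟩ := hUV
  ⟨m, hm.trans hVW, hU⟩

/-- The partial order on the index type of a family of open sets given by `RefinesBy`. -/
abbrev refinementOrder (h : IsWinningRule σ) {P : Type*} (V : P → Opens X)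
    (hV : Function.Injective V) : PartialOrder P where
  le p q := p = q ∨ RefinesBy σ (V p) (V q)
  le_refl p := Or.inl rfl
  le_trans p q r := by
    rintro (rfl | hpq) (rfl | hqr)
    · exact Or.inl rfl
    · exact Or.inr hqr
    · exact Or.inr hpq
    · exact Or.inr (hpq.trans_le (hqr.le h))
  le_antisymm p q := by
    rintro (rfl | hpq) (hqp | hqp)
    · rfl
    · rfl
    · exact hqp.symm
    · exact hV (le_antisymm (hpq.le h) (hqp.le h))

theorem refinementOrder_filter_iInter_nonempty (h : IsWinningRule σ) {P : Type*} [Countable P]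
    (V : P → Opens X) (hV : Function.Injective V) (hne : ∀ p, (V p : Set X).Nonempty) :
    letI := refinementOrder h V hV
    ∀ F : Order.PFilter P, ∃ x, ∀ p ∈ F, x ∈ V p := by
  let := refinementOrder h V hV
  have hmono : ∀ {p q : P}, p ≤ q → V p ≤ V q := by
    rintro p q (rfl | hpq)
    · exact le_rfl
    · exact hpq.le h
  intro F
  by_cases hmin : ∃ p ∈ F, ∀ q ∈ F, p ≤ q
  · obtain ⟨p, -, hp⟩ := hmin
    obtain ⟨x, hx⟩ := hne p
    exact ⟨x, fun q hq => hmono (hp q hq) hx⟩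
  push Not at hmin
  -- Without a least element, a common lower bound of `p` and some `q` with `¬ p ≤ q` cannot be `p`
  -- itself.
  have hstrict : ∀ p ∈ F, ∃ r ∈ F, RefinesBy σ (V r) (V p) := by
    intro p hp
    obtain ⟨q, hq, hpq⟩ := hmin p hp
    obtain ⟨r, hr, hrp, hrq⟩ := F.directed p hp q hq
    rcases hrp with rfl | hrp
    · exact absurd hrq hpq
    · exact ⟨r, hr, hrp⟩
  have hdir : Directed (fun p q => RefinesBy σ (V q) (V p)) (fun p : {p // p ∈ F} => p.1) := by
    rintro ⟨p, hp⟩ ⟨q, hq⟩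
    obtain ⟨r, hr, hrp, hrq⟩ := F.directed p hp q hq
    obtain ⟨t, ht, htr⟩ := hstrict r hr
    exact ⟨⟨t, ht⟩, htr.trans_le (hmono hrp), htr.trans_le (hmono hrq)⟩
  obtain ⟨p₀, hp₀⟩ := F.nonempty
  let : Inhabited {p // p ∈ F} := ⟨⟨p₀, hp₀⟩⟩
  let : Encodable {p // p ∈ F} := Encodable.ofCountable _
  -- The witnesses of refinement between consecutive terms of a cofinal sequence are Empty's moves
  -- in a play.
  choose m hm hm' using hdir.sequence_mono_nat
  obtain ⟨x, hx⟩ := h.nonempty_iInter m fun n => (hm (n + 1)).trans (hm' n)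
  rw [Set.mem_iInter] at hx
  refine ⟨x, fun p hp => (hdir.rel_sequence ⟨p, hp⟩).le h (hm _ (h.le _ (hx _)))⟩

theorem IsWinningRule.nonempty_homeomorph_maximalFilter [T1Space X] (h : IsWinningRule σ)
    {P : Type*} [Countable P] (V : P → Opens X) (hV : Function.Injective V)
    (hne : ∀ p, (V p : Set X).Nonempty)
    (hbasis : IsTopologicalBasis (Set.range fun p => (V p : Set X))) :
    letI := refinementOrder h V hV
    Nonempty (X ≃ₜ MaximalFilter P) := by
  let := refinementOrder h V hV
  have hmono : ∀ {p q : P}, p ≤ q → V p ≤ V q := by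
    rintro p q (rfl | hpq)
    · exact le_rfl
    · exact hpq.le h
  have hnhd : ∀ (x : X) (U : Opens X), x ∈ U → ∃ p, x ∈ V p ∧ V p ≤ U := by
    intro x U hx
    obtain ⟨_, ⟨p, rfl⟩, hxp, hp⟩ := hbasis.exists_subset_of_mem_open hx U.isOpen
    exact ⟨p, hxp, hp⟩
  have hF : ∀ x, Order.IsPFilter {p | x ∈ V p} := fun x => by
    refine Order.IsPFilter.of_def ?_ ?_ fun {p q} hpq hp => hmono hpq hp
    · obtain ⟨p, hp, -⟩ := hnhd x ⊤ trivial
      exact ⟨p, hp⟩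
    · intro p hp q hq
      -- A basic set inside the response to this one move refines both `V p` and `V q`.
      let m : ChoquetMove X := ⟨x, V p ⊓ V q, hp, hq⟩
      obtain ⟨r, hr, hrm⟩ := hnhd x (σ m) (h.mem m)
      exact ⟨r, hr, Or.inr ⟨m, inf_le_left, hrm⟩, Or.inr ⟨m, inf_le_right, hrm⟩⟩
  let F : X → Order.PFilter P := fun x => (hF x).toPFilter
  have hmem : ∀ x p, p ∈ F x ↔ x ∈ V p := fun x p => Iff.rfl
  have hinj : ∀ x y, F x ≤ F y → x = y := by
    intro x y hxy
    by_contra hne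
    obtain ⟨p, hp, hpU⟩ := hnhd x ⟨{y}ᶜ, isOpen_compl_singleton⟩ hne
    exact hpU (hxy ((hmem x p).2 hp) : y ∈ V p) rfl
  have hbound : ∀ G : Order.PFilter P, ∃ x, G ≤ F x := fun G =>
    refinementOrder_filter_iInter_nonempty h V hV hne G
  have hmax : ∀ x, IsMax (F x) := by
    intro x G hxG
    obtain ⟨y, hy⟩ := hbound G
    obtain rfl := hinj x y (hxG.trans hy)
    exact hy
  let f : X → MaximalFilter P := fun x => ⟨F x, hmax x⟩
  have hf : Function.Bijective f := by
    refine ⟨fun x y hxy => hinj x y (le_of_eq (congrArg Subtype.val hxy)), fun G => ?_⟩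
    obtain ⟨x, hx⟩ := hbound G.1
    exact ⟨x, Subtype.ext (le_antisymm (G.2 hx) hx)⟩
  refine ⟨(Equiv.ofBijective f hf).toHomeomorphOfIsInducing ⟨?_⟩⟩
  refine hbasis.eq_generateFrom.trans ?_
  refine Eq.trans ?_ induced_generateFrom_eq.symm
  rw [← Set.range_comp]
  rfl

end MF

theorem IsWinningRule.isMFRepresentable {X : Type u} [TopologicalSpace X]
    [SecondCountableTopology X] [T1Space X] {σ : ChoquetMove X → Opens X} (h : IsWinningRule σ) :
    IsMFRepresentable.{u, w} X := by
  -- A countable base is small, so the poset can live in any universe.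
  let e := equivShrink.{w} (countableBasis X)
  let V : Shrink.{w} (countableBasis X) → Opens X := fun p =>
    ⟨(e.symm p).1, isOpen_of_mem_countableBasis (e.symm p).2⟩
  have hV : Function.Injective V := fun p q hpq =>
    e.symm.injective (Subtype.ext (congrArg (fun U : Opens X => (U : Set X)) hpq))
  have : Countable (Shrink.{w} (countableBasis X)) := e.symm.injective.countable
  refine ⟨_, refinementOrder h V hV, h.nonempty_homeomorph_maximalFilter V hV
    (fun p => nonempty_of_mem_countableBasis (e.symm p).2) ?_⟩
  convert isBasis_countableBasis X
  ext s
  constructor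
  · rintro ⟨p, rfl⟩
    exact (e.symm p).2
  · intro hs
    exact ⟨e ⟨s, hs⟩, by simp [V]⟩

/-! ### The Scott topology and the domain of filters -/

theorem isOpen_withScott_iff {D : Type*} [PartialOrder D] {s : Set (WithScott D)} :
    IsOpen s ↔ (∀ x y : D, x ≤ y → WithScott.toScott x ∈ s → WithScott.toScott y ∈ s) ∧
      ∀ d : Set D, d.Nonempty → DirectedOn (· ≤ ·) d → ∀ a, IsLUB d a →
        WithScott.toScott a ∈ s → ∃ x ∈ d, WithScott.toScott x ∈ s := by
  rw [IsScott.isOpen_iff_isUpperSet_and_dirSupInaccOn (D := Set.univ)]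
  exact and_congr ⟨fun h x y hxy hx => h hxy hx, fun h x y hxy hx => h x y hxy hx⟩
    ⟨fun h d h1 h2 a ha has => h (Set.mem_univ _) h1 h2 ha has,
      fun h d _ h1 h2 a ha has => h d h1 h2 a ha has⟩

namespace Order.PFilter

variable {P : Type*} [PartialOrder P]

theorem exists_isLUB_and_mem_iff {d : Set (PFilter P)} (hne : d.Nonempty)
    (hd : DirectedOn (· ≤ ·) d) : ∃ F : PFilter P, IsLUB d F ∧ ∀ p, p ∈ F ↔ ∃ G ∈ d, p ∈ G := by
  have h : IsPFilter {p | ∃ G ∈ d, p ∈ G} := by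
    refine IsPFilter.of_def ?_ ?_ ?_
    · obtain ⟨G, hG⟩ := hne
      obtain ⟨p, hp⟩ := G.nonempty
      exact ⟨p, G, hG, hp⟩
    · rintro p ⟨G, hG, hp⟩ q ⟨H, hH, hq⟩
      obtain ⟨K, hK, hGK, hHK⟩ := hd G hG H hH
      obtain ⟨r, hr, hrp, hrq⟩ := K.directed p (hGK hp) q (hHK hq)
      exact ⟨r, ⟨K, hK, hr⟩, hrp, hrq⟩
    · rintro p q hpq ⟨G, hG, hp⟩
      exact ⟨G, hG, mem_of_le hpq hp⟩
  exact ⟨h.toPFilter, ⟨fun G hG p hp => ⟨G, hG, hp⟩, fun H hH p ⟨G, hG, hp⟩ => hH hG hp⟩,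
    fun p => Iff.rfl⟩

theorem exists_mem_of_isLUB {d : Set (PFilter P)} (hne : d.Nonempty)
    (hd : DirectedOn (· ≤ ·) d) {F : PFilter P} (hF : IsLUB d F) {p : P} (hp : p ∈ F) :
    ∃ G ∈ d, p ∈ G := by
  obtain ⟨F', hF', hmem⟩ := exists_isLUB_and_mem_iff hne hd
  rw [hF.unique hF'] at hp
  exact (hmem p).1 hp

theorem directedOn_principal (F : PFilter P) : DirectedOn (· ≤ ·) (principal '' (F : Set P)) := by
  rintro _ ⟨p, hp, rfl⟩ _ ⟨q, hq, rfl⟩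
  obtain ⟨r, hr, hrp, hrq⟩ := F.directed p hp q hq
  exact ⟨_, ⟨r, hr, rfl⟩, principal_le_principal_iff.2 hrp, principal_le_principal_iff.2 hrq⟩

theorem isLUB_principal (F : PFilter P) : IsLUB (principal '' (F : Set P)) F := by
  refine ⟨?_, fun G hG p hp => principal_le_iff.1 (hG ⟨p, hp, rfl⟩)⟩
  rintro _ ⟨p, hp, rfl⟩
  exact principal_le_iff.2 hp

/-- Directed suprema of filters are unions, so principal filters are compact, and each filter is the
directed supremum of those below it. -/
theorem wayBelow_iff {G F : PFilter P} : WayBelow G F ↔ ∃ p ∈ F, G ≤ principal p := by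
  constructor
  · intro h
    obtain ⟨_, ⟨p, hp, rfl⟩, hG⟩ :=
      h _ (F.nonempty.image _) F.directedOn_principal F F.isLUB_principal le_rfl
    exact ⟨p, hp, hG⟩
  · rintro ⟨p, hp, hG⟩ d hne hd a ha hFa
    obtain ⟨H, hH, hpH⟩ := exists_mem_of_isLUB hne hd ha (hFa hp)
    exact ⟨H, hH, hG.trans (principal_le_iff.2 hpH)⟩

theorem isContinuousDcpo : IsContinuousDcpo (PFilter P) where
  exists_isLUB _ hne hd := (exists_isLUB_and_mem_iff hne hd).imp fun _ h => h.1
  nonempty_wayBelow F := by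
    obtain ⟨p, hp⟩ := F.nonempty
    exact ⟨principal p, wayBelow_iff.2 ⟨p, hp, le_rfl⟩⟩
  directedOn_wayBelow F := by
    intro G hG H hH
    obtain ⟨p, hp, hGp⟩ := wayBelow_iff.1 hG
    obtain ⟨q, hq, hHq⟩ := wayBelow_iff.1 hH
    obtain ⟨r, hr, hrp, hrq⟩ := F.directed p hp q hq
    exact ⟨principal r, wayBelow_iff.2 ⟨r, hr, le_rfl⟩,
      hGp.trans (principal_le_principal_iff.2 hrp), hHq.trans (principal_le_principal_iff.2 hrq)⟩
  isLUB_wayBelow F := by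
    refine ⟨fun G hG => ?_, fun G hG p hp =>
      principal_le_iff.1 (hG (wayBelow_iff.2 ⟨p, hp, le_rfl⟩))⟩
    obtain ⟨p, hp, hGp⟩ := wayBelow_iff.1 hG
    exact hGp.trans (principal_le_iff.2 hp)

theorem isOpen_setOf_mem (p : P) :
    IsOpen {F : WithScott (PFilter P) | p ∈ WithScott.ofScott F} :=
  isOpen_withScott_iff.2 ⟨fun _ _ hxy hx => hxy hx,
    fun _ hne hd _ ha hp => exists_mem_of_isLUB hne hd ha hp⟩

theorem exists_setOf_mem_subset {s : Set (WithScott (PFilter P))} (hs : IsOpen s) {F : PFilter P}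
    (hF : WithScott.toScott F ∈ s) :
    ∃ p ∈ F, ∀ G : PFilter P, p ∈ G → WithScott.toScott G ∈ s := by
  obtain ⟨hup, hinacc⟩ := isOpen_withScott_iff.1 hs
  obtain ⟨_, ⟨p, hp, rfl⟩, hps⟩ :=
    hinacc _ (F.nonempty.image _) F.directedOn_principal F F.isLUB_principal hF
  exact ⟨p, hp, fun G hG => hup _ _ (principal_le_iff.2 hG) hps⟩

end Order.PFilter

/-- The MF space of `P` is the space of maximal elements of the domain of filters on `P`. -/
def maximalFilterHomeomorph (P : Type*) [PartialOrder P] :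
    MaximalFilter P ≃ₜ
      {F : WithScott (Order.PFilter P) // IsMax (WithScott.ofScott F)} where
  toFun F := ⟨WithScott.toScott F.1, F.2⟩
  invFun F := ⟨WithScott.ofScott F.1, F.2⟩
  left_inv _ := rfl
  right_inv _ := rfl
  continuous_toFun := by
    refine Continuous.subtype_mk (continuous_def.2 fun s hs => ?_) _
    rw [isOpen_iff_forall_mem_open]
    intro F hF
    obtain ⟨p, hp, hps⟩ := Order.PFilter.exists_setOf_mem_subset hs hF
    exact ⟨{G | p ∈ G.val}, fun G hG => hps G.1 hG, isOpen_generateFrom_of_mem ⟨p, rfl⟩, hp⟩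
  continuous_invFun := by
    refine continuous_generateFrom_iff.2 ?_
    rintro _ ⟨p, rfl⟩
    exact (Order.PFilter.isOpen_setOf_mem p).preimage continuous_subtype_val

theorem IsMFRepresentable.isDomainRepresentable {X : Type u} [TopologicalSpace X]
    (h : IsMFRepresentable.{u, w} X) : IsDomainRepresentable.{u, w} X := by
  obtain ⟨P, _, ⟨e⟩⟩ := h
  exact ⟨Order.PFilter P, inferInstance, Order.PFilter.isContinuousDcpo,
    ⟨e.trans (maximalFilterHomeomorph P)⟩⟩

/-! ### Continuous dcpos -/

namespace WayBelow

variable {D : Type*} [PartialOrder D] {x y z : D}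

theorem trans_le (h : WayBelow x y) (hyz : y ≤ z) : WayBelow x z :=
  fun d hne hd a ha hza => h d hne hd a ha (hyz.trans hza)

theorem le_trans (hxy : x ≤ y) (h : WayBelow y z) : WayBelow x z :=
  fun d hne hd a ha hza =>
    let ⟨w, hw, hyw⟩ := h d hne hd a ha hza
    ⟨w, hw, hxy.trans hyw⟩

theorem le (h : WayBelow x y) : x ≤ y := by
  obtain ⟨z, rfl, hz⟩ := h {y} (Set.singleton_nonempty y)
    (by rintro _ rfl _ rfl; exact ⟨_, rfl, le_rfl, le_rfl⟩) y isLUB_singleton le_rfl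
  exact hz

/-- Interpolation: the elements two way-below steps under `z` are already directed with supremum
`z`. -/
theorem exists_between (hD : IsContinuousDcpo D) (h : WayBelow x z) :
    ∃ y, WayBelow x y ∧ WayBelow y z := by
  let E : Set D := {u | ∃ y, WayBelow u y ∧ WayBelow y z}
  have hne : E.Nonempty := by
    obtain ⟨y, hy⟩ := hD.nonempty_wayBelow z
    obtain ⟨u, hu⟩ := hD.nonempty_wayBelow y
    exact ⟨u, y, hu, hy⟩
  have hdir : DirectedOn (· ≤ ·) E := by
    rintro u ⟨y, huy, hyz⟩ u' ⟨y', huy', hyz'⟩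
    obtain ⟨w, hwz, hyw, hyw'⟩ := hD.directedOn_wayBelow z y hyz y' hyz'
    obtain ⟨v, hvw, huv, huv'⟩ :=
      hD.directedOn_wayBelow w u (huy.trans_le hyw) u' (huy'.trans_le hyw')
    exact ⟨v, ⟨w, hvw, hwz⟩, huv, huv'⟩
  have hlub : IsLUB E z := by
    refine ⟨?_, fun b hb => (hD.isLUB_wayBelow z).2 fun y hy =>
      (hD.isLUB_wayBelow y).2 fun u hu => hb ⟨y, hu, hy⟩⟩
    rintro u ⟨y, huy, hyz⟩
    exact huy.le.trans hyz.le
  obtain ⟨u, ⟨y, huy, hyz⟩, hxu⟩ := h E hne hdir z hlub le_rfl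
  exact ⟨y, le_trans hxu huy, hyz⟩

theorem isOpen_setOf (hD : IsContinuousDcpo D) (x : D) :
    IsOpen {y : WithScott D | WayBelow x (WithScott.ofScott y)} := by
  refine isOpen_withScott_iff.2 ⟨fun y z hyz hy => trans_le hy hyz, fun d hne hd a ha hxa => ?_⟩
  obtain ⟨y, hxy, hya⟩ := exists_between hD hxa
  obtain ⟨z, hz, hyz⟩ := hya d hne hd a ha le_rfl
  exact ⟨z, hz, hxy.trans_le hyz⟩

end WayBelow

theorem IsContinuousDcpo.exists_isMax {D : Type*} [PartialOrder D] (hD : IsContinuousDcpo D)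
    (x : D) : ∃ m, x ≤ m ∧ IsMax m := by
  refine zorn_le_nonempty_Ici₀ x (fun c _ hc y hy => ?_) x le_rfl
  obtain ⟨a, ha⟩ := hD.exists_isLUB c ⟨y, hy⟩ hc.directedOn
  exact ⟨a, ha.1⟩

/-! ### From a winning system of positions to a winning rule -/

/-- A winning strategy for Nonempty, given as a relation `R` between positions. Nonempty answers
with the open set `V a` by moving to the position `a`. -/
structure IsWinningSystem {X A : Type*} [TopologicalSpace X] (R : A → A → Prop) (V : A → Opens X)
    (r : A) : Prop where
  root : V r = ⊤
  exists_next : ∀ a x (U : Opens X), x ∈ U → U ≤ V a → ∃ b, R a b ∧ x ∈ V b ∧ V b ≤ U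
  nonempty_iInter : ∀ f : ℕ → A, f 0 = r → (∀ n, R (f n) (f (n + 1))) →
    (⋂ n, (V (f n) : Set X)).Nonempty

/-- Nonempty remembers `y : D` and plays the points way above it; `none` is the start. Interpolation
makes successive elements increase in the way-below relation, and a maximal element above their
supremum gives the common point. -/
theorem IsDomainRepresentable.exists_isWinningSystem {X : Type u} [TopologicalSpace X]
    (h : IsDomainRepresentable.{u, v} X) :
    ∃ (A : Type v) (R : A → A → Prop) (V : A → Opens X) (r : A), IsWinningSystem R V r := by
  obtain ⟨D, _, hD, ⟨e⟩⟩ := h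
  let g : X → D := fun x => WithScott.ofScott (e x).1
  have hg : Continuous fun x => WithScott.toScott (g x) := continuous_subtype_val.comp e.continuous
  let V : Option D → Opens X := fun a => a.elim ⊤ fun y =>
    ⟨{x | WayBelow y (g x)}, (WayBelow.isOpen_setOf hD y).preimage hg⟩
  let R : Option D → Option D → Prop := fun a b => ∃ z, b = some z ∧ ∀ y, a = some y → WayBelow y z
  refine ⟨Option D, R, V, none, rfl, ?_, ?_⟩
  · intro a x U hx hUa
    obtain ⟨s, hs, hsU⟩ := isOpen_induced_iff.1 ((e.symm.isOpen_preimage).2 U.isOpen)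
    obtain ⟨t, ht, hts⟩ : ∃ t : Set (WithScott D), IsOpen t ∧
        ∀ x, WithScott.toScott (g x) ∈ t ↔ x ∈ U := by
      refine ⟨s, hs, fun x => ?_⟩
      have h1 : (e x).1 ∈ s ↔ e.symm (e x) ∈ U := Set.ext_iff.1 hsU (e x)
      rwa [e.symm_apply_apply] at h1
    obtain ⟨hup, hinacc⟩ := isOpen_withScott_iff.1 ht
    obtain ⟨w, hw, hwt⟩ := hinacc _ (hD.nonempty_wayBelow (g x)) (hD.directedOn_wayBelow (g x))
      (g x) (hD.isLUB_wayBelow (g x)) ((hts x).2 hx)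
    obtain ⟨z, hz, hwz, hza⟩ : ∃ z, WayBelow z (g x) ∧ w ≤ z ∧
        ∀ y, a = some y → WayBelow y z := by
      cases a with
      | none => exact ⟨w, hw, le_rfl, by simp⟩
      | some y =>
        obtain ⟨u, hyu, hux⟩ := WayBelow.exists_between hD (hUa hx : WayBelow y (g x))
        obtain ⟨z, hz, huz, hwz⟩ := hD.directedOn_wayBelow (g x) u hux w hw
        refine ⟨z, hz, hwz, ?_⟩
        rintro _ ⟨⟩
        exact hyu.trans_le huz
    refine ⟨some z, ⟨z, rfl, hza⟩, hz, fun x' hx' => (hts x').1 ?_⟩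
    exact hup w _ (hwz.trans (WayBelow.le hx')) hwt
  · intro f hf0 hf
    choose z hz hyz using hf
    have hzz : ∀ n, WayBelow (z n) (z (n + 1)) := fun n => hyz (n + 1) _ (hz n)
    have hmono : Monotone z := monotone_nat_of_le_succ fun n => (hzz n).le
    obtain ⟨a, ha⟩ := hD.exists_isLUB (Set.range z) (Set.range_nonempty z)
      hmono.directed_le.directedOn_range
    obtain ⟨m, ham, hm⟩ := hD.exists_isMax a
    refine ⟨e.symm ⟨WithScott.toScott m, hm⟩, Set.mem_iInter.2 fun n => ?_⟩
    cases n with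
    | zero => rw [hf0]; trivial
    | succ n =>
      rw [hz n]
      change WayBelow (z n) (WithScott.ofScott (e (e.symm ⟨WithScott.toScott m, hm⟩)).1)
      rw [e.apply_symm_apply]
      exact (hzz n).trans_le ((ha.1 ⟨n + 1, rfl⟩).trans ham)

/-- The open sets `W n k` shrink the members `β k` of a base in such a way that an open set
containing a nonisolated point is contained in `W n k` for finitely many `n` only. -/
theorem exists_shrinking (X : Type u) [TopologicalSpace X] [SecondCountableTopology X]
    [T1Space X] : ∃ (K : Type u) (_ : Countable K) (β : K → Opens X) (W : ℕ → K → Opens X),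
      (∀ n k, W n k ≤ β k) ∧ (∀ x (U : Opens X), x ∈ U → ∃ k, β k ≤ U ∧ ∀ n, x ∈ W n k) ∧
      ∀ x (U : Opens X), x ∈ U → ¬ IsOpen {x} → ∃ i, ∀ n k, U ≤ W n k → n ≤ i := by
  have hpair : ∀ i : countableBasis X, ∃ a b, a ∈ i.1 ∧ b ∈ i.1 ∧ (i.1.Nontrivial → a ≠ b) := by
    intro i
    by_cases hi : i.1.Nontrivial
    · obtain ⟨a, ha, b, hb, hab⟩ := hi
      exact ⟨a, b, ha, hb, fun _ => hab⟩
    · obtain ⟨a, ha⟩ := nonempty_of_mem_countableBasis i.2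
      exact ⟨a, a, ha, ha, fun h => absurd h hi⟩
  choose a b ha hb hab using hpair
  -- Two points are marked in each basic set, distinct when possible. `W n k` removes the marked
  -- points of the sets with code below `n`, sparing only `q k.2`. The spared point lets one `k`
  -- keep `x` for all `n`; a nontrivial basic set has two marked points, so it cannot avoid the
  -- removal once `n` exceeds its code.
  let q : countableBasis X × Bool → X := fun j => if j.2 then a j.1 else b j.1
  let F : ℕ → Set X := fun n => q '' {j | Encodable.encode j.1 < n}
  have hF : ∀ n, (F n).Finite := by
    intro n
    refine Set.Finite.image _ ?_
    have h1 : {i : countableBasis X | Encodable.encode i < n}.Finite :=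
      (Set.finite_Iio n).preimage Encodable.encode_injective.injOn
    exact (h1.prod Set.finite_univ).subset fun j hj => ⟨hj, trivial⟩
  have hbase : ∀ x (U : Opens X), x ∈ U → ∃ l : countableBasis X, x ∈ l.1 ∧ l.1 ⊆ U := by
    intro x U hx
    obtain ⟨l, hl, hxl, hlU⟩ :=
      (isBasis_countableBasis X).exists_subset_of_mem_open (show x ∈ (U : Set X) from hx) U.isOpen
    exact ⟨⟨l, hl⟩, hxl, hlU⟩
  let β : countableBasis X × (countableBasis X × Bool) → Opens X := fun k =>
    ⟨k.1.1, isOpen_of_mem_countableBasis k.1.2⟩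
  refine ⟨countableBasis X × (countableBasis X × Bool), inferInstance, β,
    fun n k => β k ⊓ ⟨(F n \ {q k.2})ᶜ, ((hF n).subset Set.sdiff_subset).isClosed.isOpen_compl⟩,
    fun n k => inf_le_left, fun x U hx => ?_, fun x U hx hiso => ?_⟩
  · obtain ⟨l, hxl, hlU⟩ := hbase x U hx
    by_cases hxq : ∃ c, q c = x
    · obtain ⟨c, hc⟩ := hxq
      exact ⟨(l, c), hlU, fun n => ⟨hxl, fun h => h.2 hc.symm⟩⟩
    · refine ⟨(l, (l, true)), hlU, fun n => ⟨hxl, fun h => hxq ?_⟩⟩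
      obtain ⟨c, -, hc⟩ := h.1
      exact ⟨c, hc⟩
  · obtain ⟨i, hxi, hiU⟩ := hbase x U hx
    have hnt : i.1.Nontrivial := by
      by_contra hi
      rw [Set.not_nontrivial_iff] at hi
      have := isOpen_of_mem_countableBasis i.2
      rw [hi.eq_singleton_of_mem hxi] at this
      exact hiso this
    refine ⟨Encodable.encode i, fun n k hU => ?_⟩
    by_contra! hn
    have h1 : ∀ j : countableBasis X × Bool, j.1 = i → q j = q k.2 := by
      rintro ⟨j, t⟩ rfl
      by_contra hne
      have hqU : q (j, t) ∈ U := hiU (by cases t; exacts [hb j, ha j])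
      exact (hU hqU).2 ⟨⟨(j, t), hn, rfl⟩, hne⟩
    exact hab i hnt ((h1 (i, true) rfl).trans (h1 (i, false) rfl).symm)

theorem IsWinningSystem.exists_isWinningRule {X : Type u} [TopologicalSpace X]
    [SecondCountableTopology X] [T1Space X] {A : Type v} {R : A → A → Prop} {V : A → Opens X}
    {r : A} (h : IsWinningSystem R V r) : ∃ σ : ChoquetMove X → Opens X, IsWinningRule σ := by
  classical
  obtain ⟨K, _, β, W, hWβ, hW, hfin⟩ := exists_shrinking X
  let : Encodable K := Encodable.ofCountable K
  let P : A → K × K → A → Prop := fun a k b => R a b ∧ β k.1 ≤ V b ∧ V b ≤ β k.2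
  -- Only a basic set inside `V b` and one around it are recorded: any `b` in the sandwich serves as
  -- well, and histories become countably many.
  let next : A → K × K → A := fun a k => if hk : ∃ b, P a k b then hk.choose else a
  have hnext : ∀ a k, (∃ b, P a k b) → P a k (next a k) := by
    intro a k hk
    simp only [next, dif_pos hk]
    exact hk.choose_spec
  let st : List (K × K) → A := fun s => s.foldr (fun k a => next a k) r
  let N : List (K × K) → Opens X := fun s =>
    match s with
    | [] => ⊤
    -- The index depends on `k` itself, hence the need for `x ∈ W n k` at all `n`.
    | k :: s => W (Encodable.encode (k :: s)) k.1
  have hchild : ∀ s x (U : Opens X), x ∈ U → U ≤ V (st s) → ∃ k : K × K,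
      x ∈ N (k :: s) ∧ N (k :: s) ≤ V (st (k :: s)) ∧ V (st (k :: s)) ≤ U ∧
        R (st s) (st (k :: s)) := by
    intro s x U hx hU
    obtain ⟨k₂, hk₂, hxk₂⟩ := hW x U hx
    obtain ⟨b, hRb, hxb, hb⟩ :=
      h.exists_next (st s) x (β k₂) (hWβ 0 _ (hxk₂ 0)) (hk₂.trans hU)
    obtain ⟨k₁, hk₁, hxk₁⟩ := hW x (V b) hxb
    obtain ⟨h1, h2, h3⟩ := hnext (st s) (k₁, k₂) ⟨b, hRb, hk₁, hb⟩
    exact ⟨(k₁, k₂), hxk₁ _, (hWβ _ _).trans h2, h3.trans hk₂, h1⟩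
  have hfinite : ∀ x (U : Opens X), x ∈ U → ¬ IsOpen {x} → {s | U ≤ N s}.Finite := by
    intro x U hx hiso
    obtain ⟨i, hi⟩ := hfin x U hx hiso
    refine (((Set.finite_Iic i).preimage Encodable.encode_injective.injOn).insert
      ([] : List (K × K))).subset fun s hs => ?_
    cases s with
    | nil => exact Or.inl rfl
    | cons k s => exact Or.inr (hi _ _ hs)
  have hmove : ∀ m : ChoquetMove X, ∃ O : Opens X, m.point ∈ O ∧ O ≤ m.nhd ∧
      (IsOpen {m.point} → (O : Set X) = {m.point}) ∧
      (¬ IsOpen {m.point} → ∀ s, m.nhd ≤ N s → m.nhd ≤ V (st s) → ∃ k : K × K,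
        O ≤ N (k :: s) ∧ N (k :: s) ≤ V (st (k :: s)) ∧ V (st (k :: s)) ≤ m.nhd ∧
          R (st s) (st (k :: s))) := by
    intro m
    by_cases hiso : IsOpen {m.point}
    · exact ⟨⟨{m.point}, hiso⟩, rfl, fun y hy => by
        rw [Set.mem_singleton_iff.1 hy]; exact m.mem, fun _ => rfl, fun h => absurd hiso h⟩
    have hk : ∀ s : {s // m.nhd ≤ N s ∧ m.nhd ≤ V (st s)}, ∃ k : K × K,
        m.point ∈ N (k :: s.1) ∧ N (k :: s.1) ≤ V (st (k :: s.1)) ∧ V (st (k :: s.1)) ≤ m.nhd ∧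
          R (st s.1) (st (k :: s.1)) :=
      fun s => hchild s.1 m.point m.nhd m.mem s.2.2
    choose k hk1 hk2 using hk
    have : Finite {s // m.nhd ≤ N s ∧ m.nhd ≤ V (st s)} :=
      ((hfinite _ _ m.mem hiso).subset fun s hs => hs.1).to_subtype
    -- One response enters the chosen extension of every compatible history; the intersection is
    -- open because these are finitely many.
    refine ⟨m.nhd ⊓ ⟨⋂ s, (N (k s :: s.1) : Set X), isOpen_iInter_of_finite fun s =>
      (N (k s :: s.1)).isOpen⟩, ⟨m.mem, Set.mem_iInter.2 hk1⟩, inf_le_left,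
      fun h => absurd h hiso, fun _ s hs hs' => ⟨k ⟨s, hs, hs'⟩, ?_, hk2 _⟩⟩
    exact fun y hy => Set.mem_iInter.1 hy.2 ⟨s, hs, hs'⟩
  choose σ hσmem hσle hσiso hσ using hmove
  refine ⟨σ, hσmem, hσle, fun e he => ?_⟩
  have hanti : Antitone fun n => σ (e n) :=
    antitone_nat_of_succ_le fun n => (hσle _).trans (he n)
  by_cases hiso : ∃ n, IsOpen {(e n).point}
  · obtain ⟨n, hn⟩ := hiso
    refine ⟨(e n).point, Set.mem_iInter.2 fun j => ?_⟩
    rcases le_total j n with hj | hj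
    · exact hanti hj (hσmem (e n))
    · have h1 : (e j).point ∈ (σ (e n) : Set X) := hanti hj (hσmem (e j))
      rw [hσiso _ hn, Set.mem_singleton_iff] at h1
      rw [← h1]
      exact hσmem (e j)
  push Not at hiso
  have hk : ∀ n s, ∃ k : K × K, (e n).nhd ≤ N s → (e n).nhd ≤ V (st s) →
      σ (e n) ≤ N (k :: s) ∧ N (k :: s) ≤ V (st (k :: s)) ∧ V (st (k :: s)) ≤ (e n).nhd ∧
        R (st s) (st (k :: s)) := by
    intro n s
    by_cases hs : (e n).nhd ≤ N s ∧ (e n).nhd ≤ V (st s)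
    · obtain ⟨k, hk⟩ := hσ (e n) (hiso n) s hs.1 hs.2
      exact ⟨k, fun _ _ => hk⟩
    · obtain ⟨k, -⟩ := hW (e n).point ⊤ trivial
      exact ⟨(k, k), fun h1 h2 => absurd ⟨h1, h2⟩ hs⟩
  choose k hk using hk
  -- One actual history is recovered along the play; the strategy never needs to know it.
  let s : ℕ → List (K × K) := fun n => Nat.rec [] (fun n s => k n s :: s) n
  have hinv : ∀ n, (e n).nhd ≤ N (s n) ∧ (e n).nhd ≤ V (st (s n)) := by
    intro n
    induction n with
    | zero => exact ⟨le_top, le_top.trans_eq h.root.symm⟩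
    | succ n ih =>
      obtain ⟨h1, h2, -, -⟩ := hk n (s n) ih.1 ih.2
      exact ⟨(he n).trans h1, (he n).trans (h1.trans h2)⟩
  obtain ⟨y, hy⟩ := h.nonempty_iInter (fun n => st (s n)) rfl fun n =>
    (hk n (s n) (hinv n).1 (hinv n).2).2.2.2
  rw [Set.mem_iInter] at hy
  -- Position `n + 2` lies inside Empty's move `n + 1`, which lies inside response `n`.
  refine ⟨y, Set.mem_iInter.2 fun n => he n ?_⟩
  exact (hk (n + 1) (s (n + 1)) (hinv _).1 (hinv _).2).2.2.1 (hy (n + 2))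

theorem IsDomainRepresentable.exists_isWinningRule {X : Type u} [TopologicalSpace X]
    [SecondCountableTopology X] [T1Space X] (h : IsDomainRepresentable.{u, v} X) :
    ∃ σ : ChoquetMove X → Opens X, IsWinningRule σ :=
  let ⟨_, _, _, _, hsys⟩ := h.exists_isWinningSystem
  hsys.exists_isWinningRule

theorem corollaryC (X : Type u) [TopologicalSpace X] [SecondCountableTopology X] [T1Space X] :
    (HasStationaryWinningStrategy X ↔ IsDomainRepresentable.{u, v} X) ∧
    (HasStationaryWinningStrategy X ↔ IsMFRepresentable.{u, w} X) := by
  refine ⟨⟨fun h => ?_, fun h => ?_⟩, ⟨fun h => ?_, fun h => ?_⟩⟩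
  · obtain ⟨σ, hσ⟩ := h.exists_isWinningRule
    exact hσ.isMFRepresentable.isDomainRepresentable
  · obtain ⟨σ, hσ⟩ := h.exists_isWinningRule
    exact hσ.hasStationaryWinningStrategy
  · obtain ⟨σ, hσ⟩ := h.exists_isWinningRule
    exact hσ.isMFRepresentable
  · obtain ⟨σ, hσ⟩ := h.isDomainRepresentable.exists_isWinningRule
    exact hσ.hasStationaryWinningStrategy
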